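/- Let $\Theta$ be a variety of algebras, given by a signature of operation symbols (constants allowed) and a set of identities. Let $X^0$ be an infinite set of variables, $X=\{x_1,\dots,x_n\}$ a finite subset of $X^0$, and write $W(Y)$ for the algebra free in $\Theta$ over $Y$; assume that $W(X)$ is non-empty (that is, $X\neq\emptyset$ or the signature has a constant). For $H\in\Theta$, a point is a homomorphism $\mu:W(X)\to H$. The multi-sorted algebra of formulas $\widetilde\Phi=(\Phi(Y))$, $Y$ ranging over the finite subsets of $X^0$, is the free Halmos algebra over the equalities $w\equiv w'$ ($w,w'\in W(Y)$): the absolutely free algebra over these equalities with Boolean operations, quantifiers $\exists y$ ($y\in Y$) and operations $s_*:\Phi(Y)\to\Phi(Z)$ for all homomorphisms $s:W(Y)\to W(Z)$, modulo the identities of Halmos algebras over $\Theta$. For $H\in\Theta$ let $\mathrm{Val}_H$ be the unique homomorphism from $\widetilde\Phi$ to the Halmos algebra of all subsets of the sets $\mathrm{Hom}(W(Y),H)$, in which $w\equiv w'$ is $\{\mu: w^\mu=w'^\mu\}$, $\exists y A$ is the set of points that agree with some point of $A$ on $Y\setminus\{y\}$, and $s_*A=\{\mu:\mu s\in A\}$.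 The logical kernel of $\mu:W(X)\to H$ is $$LKer(\mu)=\{u\in\Phi(X):\mu\in \mathrm{Val}^X_H(u)\}.$$ Let $\Phi(X^0)$ be the Lindenbaum–Tarski algebra of first-order formulas built from equalities $w\equiv w'$, $w,w'\in W(X^0)$, with quantifiers over variables in $X^0$: formulas modulo provable equivalence in first-order logic with equality over $\Theta$. An element of $\Phi(X^0)$ is $X$-special if it is represented by a formula all of whose free variables lie in $X$ and all of whose bound variables lie in $X^0\setminus X$. The model-theoretic type $Tp^H(\mu)$ of a point $\mu:W(X)\to H$ is the set of all $X$-special $u=u(x_1,\dots,x_n;y_1,\dots,y_m)\in\Phi(X^0)$ such that the closed formula $u(\mu(x_1),\dots,\mu(x_n);y_1,\dots,y_m)$ is satisfied in $H$. **Theorem.** Let $H_1,H_2\in\Theta$ and let points $\mu:W(X)\to H_1$ and $\nu:W(X)\to H_2$ be given. Then $$Tp^{H_1}(\mu)=Tp^{H_2}(\nu)\iff LKer(\mu)=LKer(\nu).$$ -/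

import Mathlib

open scoped FirstOrder
open FirstOrder.Language (Term Hom Substructure)
open FirstOrder.Language.Structure (funMap)

namespace AlgLogic

universe u u' v w

/-! ## Varieties and free algebras

The signature `L` is a first-order language without relation symbols (constants are allowed), and
a variety `Θ` is given by a set `E` of identities between terms. -/

/-- `H` is an algebra of the variety `Θ` defined by the identities `E`. -/
class InVariety {L : FirstOrder.Language.{u, u'}} (E : Set (L.Term ℕ × L.Term ℕ)) (H : Type w)
    [L.Structure H] : Prop where
  holds : ∀ e ∈ E, ∀ a : ℕ → H, e.1.realize a = e.2.realize a

/-- The fully invariant congruence generated by the identities `E`, on terms in the variables `α`: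
equality of terms derivable from `E`. -/
inductive TermEq {L : FirstOrder.Language.{u, u'}} (E : Set (L.Term ℕ × L.Term ℕ)) {α : Type v} :
    L.Term α → L.Term α → Prop
  | refl (t : L.Term α) : TermEq E t t
  | symm {t t' : L.Term α} : TermEq E t t' → TermEq E t' t
  | trans {t t' t'' : L.Term α} : TermEq E t t' → TermEq E t' t'' → TermEq E t t''
  | func {n : ℕ} (f : L.Functions n) {t t' : Fin n → L.Term α} :
      (∀ i, TermEq E (t i) (t' i)) → TermEq E (Term.func f t) (Term.func f t')
  | ident {e : L.Term ℕ × L.Term ℕ} (he : e ∈ E) (σ : ℕ → L.Term α) :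
      TermEq E (e.1.subst σ) (e.2.subst σ)

def termSetoid {L : FirstOrder.Language.{u, u'}} (E : Set (L.Term ℕ × L.Term ℕ)) (α : Type v) :
    Setoid (L.Term α) where
  r := TermEq E
  iseqv := ⟨TermEq.refl, TermEq.symm, TermEq.trans⟩

/-- The algebra `W(α)`, free over `α` in the variety defined by `E`. -/
def FreeAlg {L : FirstOrder.Language.{u, u'}} (E : Set (L.Term ℕ × L.Term ℕ)) (α : Type v) :
    Type (max u v) :=
  Quotient (termSetoid E α)

namespace FreeAlg

variable {L : FirstOrder.Language.{u, u'}} {E : Set (L.Term ℕ × L.Term ℕ)} {α : Type v}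

def mk (t : L.Term α) : FreeAlg E α := Quotient.mk (termSetoid E α) t

/-- The free generators. -/
def var (x : α) : FreeAlg E α := mk (Term.var x)

noncomputable instance [L.IsAlgebraic] : L.Structure (FreeAlg E α) where
  funMap f a := mk (Term.func f fun i => (a i).out)
  RelMap {n} r _ := ((inferInstance : IsEmpty (L.Relations n)).false r).elim

variable [L.IsAlgebraic]

theorem funMap_mk {n : ℕ} (f : L.Functions n) (t : Fin n → L.Term α) :
    (funMap f fun i => (mk (t i) : FreeAlg E α)) = mk (Term.func f t) :=
  Quotient.sound (s := termSetoid E α)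
    (TermEq.func f fun i => Quotient.exact (s := termSetoid E α) (Quotient.out_eq _))

theorem realize_mk {β : Type*} (t : L.Term β) (a : β → L.Term α) :
    t.realize (fun i => (mk (a i) : FreeAlg E α)) = mk (t.subst a) := by
  induction t with
  | var => rfl
  | func f ts ih => simp only [Term.realize_func, ih, funMap_mk, Term.subst]

/-- The free algebra belongs to the variety. -/
instance : InVariety E (FreeAlg E α) where
  holds e he a := by
    have h : a = fun i => mk ((a i).out) := funext fun i => (Quotient.out_eq (a i)).symm
    rw [h, realize_mk, realize_mk]
    exact Quotient.sound (s := termSetoid E α) (TermEq.ident he _)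

variable {H : Type w} [L.Structure H]

theorem realize_eq_of_termEq [hH : InVariety E H] (a : α → H) {t t' : L.Term α}
    (h : TermEq E t t') : t.realize a = t'.realize a := by
  induction h with
  | refl => rfl
  | symm _ ih => exact ih.symm
  | trans _ _ ih ih' => exact ih.trans ih'
  | func f _ ih => simp only [Term.realize_func, ih]
  | ident he σ => simp only [Term.realize_subst]; exact hH.holds _ he _

/-- The universal property: a map `α → H` into an algebra of the variety extends to `W(α)`. -/
def lift [InVariety E H] (a : α → H) : FreeAlg E α →[L] H where
  toFun := Quotient.lift (fun t => t.realize a) fun _ _ h => realize_eq_of_termEq a h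
  map_fun' {n} f x := by
    have h : x = fun i => mk ((x i).out) := funext fun i => (Quotient.out_eq (x i)).symm
    rw [h, funMap_mk]
    rfl
  map_rel' {n} r _ := ((inferInstance : IsEmpty (L.Relations n)).false r).elim

@[simp] theorem lift_var [InVariety E H] (a : α → H) (x : α) :
    lift a (var x : FreeAlg E α) = a x := rfl

theorem closure_var : Substructure.closure L (Set.range (var : α → FreeAlg E α)) = ⊤ := by
  refine eq_top_iff.2 fun w hw => ?_
  clear hw
  obtain ⟨t, rfl⟩ := Quotient.exists_rep w
  change mk t ∈ _
  induction t with
  | var x => exact Substructure.subset_closure ⟨x, rfl⟩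
  | func f ts ih =>
    rw [← funMap_mk]
    exact (Substructure.closure L _).fun_mem f _ ih

theorem hom_ext {f g : FreeAlg E α →[L] H} (h : ∀ x, f (var x) = g (var x)) : f = g :=
  Hom.eq_of_eqOn_dense closure_var (by rintro _ ⟨x, rfl⟩; exact h x)

/-- `w ∈ W(α)` involves only variables from `S`: it lies in the subalgebra generated by `S`. -/
def Involves (S : Set α) (w : FreeAlg E α) : Prop :=
  w ∈ Substructure.closure L ((var : α → FreeAlg E α) '' S)

theorem hom_eq_of_involves {f g : FreeAlg E α →[L] H} {S : Set α}
    (h : ∀ x ∈ S, f (var x) = g (var x)) {w : FreeAlg E α} (hw : Involves S w) : f w = g w :=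
  Hom.eqOn_closure (by rintro _ ⟨x, hx, rfl⟩; exact h x hx) hw

open Classical in
/-- The endomorphism of `W(α)` that takes the variable `x` to `w` and fixes the others. -/
noncomputable def replace (x : α) (w : FreeAlg E α) : FreeAlg E α →[L] FreeAlg E α :=
  lift (Function.update var x w)

theorem replace_var_self (x : α) (w : FreeAlg E α) : replace x w (var x) = w := by
  simp [replace]

theorem replace_var_of_ne {x y : α} (h : y ≠ x) (w : FreeAlg E α) :
    replace x w (var y) = var y := by
  simp [replace, h]

end FreeAlg

/-! ## Sets of points -/

section Points

variable {L : FirstOrder.Language.{u, u'}} [L.IsAlgebraic] {E : Set (L.Term ℕ × L.Term ℕ)} {α : Type v}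
  {H : Type w} [L.Structure H]

/-- The equality `[w ≡ w']_H`, as a set of points `W(α) → H`. -/
def pointsEq (H : Type w) [L.Structure H] (w w' : FreeAlg E α) : Set (FreeAlg E α →[L] H) :=
  {μ | μ w = μ w'}

/-- The quantifier `∃ x` on sets of points: `μ ∈ ∃ x A` if some `ν ∈ A` agrees with `μ` on all
variables other than `x`. -/
def pointsEx (x : α) (A : Set (FreeAlg E α →[L] H)) : Set (FreeAlg E α →[L] H) :=
  {μ | ∃ ν ∈ A, ∀ y, y ≠ x → μ (FreeAlg.var y) = ν (FreeAlg.var y)}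

end Points

/-! ## The multi-sorted algebra of formulas

`V` is the infinite set `X⁰` of all variables; the sorts are the finite subsets `X` of `V`. -/

section MultiSorted

variable {L : FirstOrder.Language.{u, u'}} [L.IsAlgebraic] (E : Set (L.Term ℕ × L.Term ℕ)) {V : Type v}

/-- `W(X)` for a finite set `X` of variables. -/
abbrev W (X : Finset V) : Type (max u v) := FreeAlg E {x // x ∈ X}

/-- The absolutely free multi-sorted algebra over the equalities, in the signature of Halmos
algebras: Boolean operations, quantifiers `∃ x` with `x ∈ X`, equalities `w ≡ w'` with
`w, w' ∈ W(X)`, and an operation `s_*` from sort `X` to sort `Y` for every homomorphism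
`s : W(X) → W(Y)`. -/
inductive Form : Finset V → Type (max u u' v)
  | eq {X : Finset V} (w w' : W E X) : Form X
  | bot {X : Finset V} : Form X
  | top {X : Finset V} : Form X
  | neg {X : Finset V} (a : Form X) : Form X
  | and {X : Finset V} (a b : Form X) : Form X
  | or {X : Finset V} (a b : Form X) : Form X
  | ex {X : Finset V} (x : {x // x ∈ X}) (a : Form X) : Form X
  | subst {X Y : Finset V} (s : W E X →[L] W E Y) (a : Form X) : Form Y

variable {E}

/-- The conjunction of the equalities `w i ≡ w' i`. -/
def Form.eqs {X : Finset V} {n : ℕ} (w w' : Fin n → W E X) : Form E X :=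
  (List.ofFn fun i => Form.eq (w i) (w' i)).foldr Form.and Form.top

/-- The verbal congruence of the identities of (multi-sorted) Halmos algebras over `Θ`. An
inequality `a ≤ b` of Boolean algebras is written as the identity `a ∧ b = a`. -/
inductive HalEq : {X : Finset V} → Form E X → Form E X → Prop
  -- congruence rules
  | refl {X : Finset V} (a : Form E X) : HalEq a a
  | symm {X : Finset V} {a b : Form E X} : HalEq a b → HalEq b a
  | trans {X : Finset V} {a b c : Form E X} : HalEq a b → HalEq b c → HalEq a c
  | neg_congr {X : Finset V} {a a' : Form E X} : HalEq a a' → HalEq a.neg a'.neg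
  | and_congr {X : Finset V} {a a' b b' : Form E X} :
      HalEq a a' → HalEq b b' → HalEq (a.and b) (a'.and b')
  | or_congr {X : Finset V} {a a' b b' : Form E X} :
      HalEq a a' → HalEq b b' → HalEq (a.or b) (a'.or b')
  | ex_congr {X : Finset V} (x : {x // x ∈ X}) {a a' : Form E X} :
      HalEq a a' → HalEq (a.ex x) (a'.ex x)
  | subst_congr {X Y : Finset V} (s : W E X →[L] W E Y) {a a' : Form E X} :
      HalEq a a' → HalEq (a.subst s) (a'.subst s)
  -- Boolean algebras
  | and_comm {X : Finset V} (a b : Form E X) : HalEq (a.and b) (b.and a)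
  | or_comm {X : Finset V} (a b : Form E X) : HalEq (a.or b) (b.or a)
  | and_assoc {X : Finset V} (a b c : Form E X) : HalEq ((a.and b).and c) (a.and (b.and c))
  | or_assoc {X : Finset V} (a b c : Form E X) : HalEq ((a.or b).or c) (a.or (b.or c))
  | and_or_self {X : Finset V} (a b : Form E X) : HalEq (a.and (a.or b)) a
  | or_and_self {X : Finset V} (a b : Form E X) : HalEq (a.or (a.and b)) a
  | and_or {X : Finset V} (a b c : Form E X) :
      HalEq (a.and (b.or c)) ((a.and b).or (a.and c))
  | or_and {X : Finset V} (a b c : Form E X) :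
      HalEq (a.or (b.and c)) ((a.or b).and (a.or c))
  | and_neg {X : Finset V} (a : Form E X) : HalEq (a.and a.neg) Form.bot
  | or_neg {X : Finset V} (a : Form E X) : HalEq (a.or a.neg) Form.top
  -- quantifiers
  | ex_bot {X : Finset V} (x : {x // x ∈ X}) : HalEq ((Form.bot : Form E X).ex x) Form.bot
  | le_ex {X : Finset V} (x : {x // x ∈ X}) (a : Form E X) : HalEq (a.and (a.ex x)) a
  | ex_and_ex {X : Finset V} (x : {x // x ∈ X}) (a b : Form E X) :
      HalEq ((a.and (b.ex x)).ex x) ((a.ex x).and (b.ex x))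
  | ex_comm {X : Finset V} (x y : {x // x ∈ X}) (a : Form E X) :
      HalEq ((a.ex y).ex x) ((a.ex x).ex y)
  -- equalities
  | eq_refl {X : Finset V} (w : W E X) : HalEq (Form.eq w w) Form.top
  | eq_symm {X : Finset V} (w w' : W E X) :
      HalEq ((Form.eq w w').and (Form.eq w' w)) (Form.eq w w')
  | eq_trans {X : Finset V} (w w' w'' : W E X) :
      HalEq (((Form.eq w w').and (Form.eq w' w'')).and (Form.eq w w''))
        ((Form.eq w w').and (Form.eq w' w''))
  | eq_func {X : Finset V} {n : ℕ} (f : L.Functions n) (w w' : Fin n → W E X) :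
      HalEq ((Form.eqs w w').and (Form.eq (funMap f w) (funMap f w'))) (Form.eqs w w')
  -- each `s_*` is a homomorphism of Boolean algebras, functorially in `s`
  | subst_bot {X Y : Finset V} (s : W E X →[L] W E Y) :
      HalEq ((Form.bot : Form E X).subst s) Form.bot
  | subst_top {X Y : Finset V} (s : W E X →[L] W E Y) :
      HalEq ((Form.top : Form E X).subst s) Form.top
  | subst_neg {X Y : Finset V} (s : W E X →[L] W E Y) (a : Form E X) :
      HalEq (a.neg.subst s) (a.subst s).neg
  | subst_and {X Y : Finset V} (s : W E X →[L] W E Y) (a b : Form E X) :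
      HalEq ((a.and b).subst s) ((a.subst s).and (b.subst s))
  | subst_or {X Y : Finset V} (s : W E X →[L] W E Y) (a b : Form E X) :
      HalEq ((a.or b).subst s) ((a.subst s).or (b.subst s))
  | subst_id {X : Finset V} (a : Form E X) : HalEq (a.subst (Hom.id L (W E X))) a
  | subst_comp {X Y Z : Finset V} (s : W E X →[L] W E Y) (s' : W E Y →[L] W E Z) (a : Form E X) :
      HalEq ((a.subst s).subst s') (a.subst (s'.comp s))
  -- `s_*` and quantifiers
  | subst_ex_eq {X Y : Finset V} (s s' : W E X →[L] W E Y) (x : {x // x ∈ X}) (a : Form E X) :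
      (∀ x', x' ≠ x → s (FreeAlg.var x') = s' (FreeAlg.var x')) →
      HalEq ((a.ex x).subst s) ((a.ex x).subst s')
  | subst_ex {X Y : Finset V} (s : W E X →[L] W E Y) (x : {x // x ∈ X}) (y : {y // y ∈ Y})
      (a : Form E X) :
      s (FreeAlg.var x) = FreeAlg.var y →
      (∀ x', x' ≠ x → FreeAlg.Involves {y}ᶜ (s (FreeAlg.var x'))) →
      HalEq ((a.ex x).subst s) ((a.subst s).ex y)
  -- `s_*` and equalities
  | subst_eq {X Y : Finset V} (s : W E X →[L] W E Y) (w w' : W E X) :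
      HalEq ((Form.eq w w').subst s) (Form.eq (s w) (s w'))
  | subst_replace {X : Finset V} (x : {x // x ∈ X}) (w w' : W E X) (a : Form E X) :
      HalEq
        (((a.subst (FreeAlg.replace x w)).and (Form.eq w w')).and
          (a.subst (FreeAlg.replace x w')))
        ((a.subst (FreeAlg.replace x w)).and (Form.eq w w'))

variable (E) in
def formSetoid (X : Finset V) : Setoid (Form E X) where
  r := HalEq
  iseqv := ⟨HalEq.refl, HalEq.symm, HalEq.trans⟩

variable (E) in
/-- The algebra of formulas `Φ(X)`: the component of sort `X` of the free multi-sorted Halmos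
algebra over the equalities. -/
def Φ (X : Finset V) : Type (max u u' v) := Quotient (formSetoid E X)

variable (H : Type w) [L.Structure H]

/-- The values of formulas in the Halmos algebra of all sets of points with values in `H`; the
operation `s_*` takes `A` to the set of points `μ` with `μ s ∈ A`. -/
def Form.val : {X : Finset V} → Form E X → Set (W E X →[L] H)
  | _, .eq w w' => pointsEq H w w'
  | _, .bot => ∅
  | _, .top => Set.univ
  | _, .neg a => (a.val)ᶜ
  | _, .and a b => a.val ∩ b.val
  | _, .or a b => a.val ∪ b.val
  | _, .ex x a => pointsEx x a.val
  | _, .subst s a => {μ | μ.comp s ∈ a.val}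

theorem Form.mem_val_eqs {X : Finset V} {n : ℕ} (w w' : Fin n → W E X) (μ : W E X →[L] H) :
    μ ∈ (Form.eqs w w').val H ↔ ∀ i, μ (w i) = μ (w' i) := by
  have key : ∀ l : List (Form E X),
      μ ∈ (l.foldr Form.and Form.top).val H ↔ ∀ a ∈ l, μ ∈ a.val H := by
    intro l
    induction l with
    | nil => simp [Form.val]
    | cons a l ih => simp [Form.val, ih]
  rw [Form.eqs, key]
  simp only [List.mem_ofFn]
  constructor
  · intro h i
    exact h _ ⟨i, rfl⟩
  · rintro h _ ⟨i, rfl⟩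
    exact h i

/-- The identities of Halmos algebras hold in the algebra of sets of points. -/
theorem HalEq.val_eq [InVariety E H] {X : Finset V} {a b : Form E X} (h : HalEq a b) :
    a.val H = b.val H := by
  classical
  induction h with
  | refl => rfl
  | symm _ ih => exact ih.symm
  | trans _ _ ih ih' => exact ih.trans ih'
  | neg_congr _ ih => simp only [Form.val, ih]
  | and_congr _ _ ih ih' => simp only [Form.val, ih, ih']
  | or_congr _ _ ih ih' => simp only [Form.val, ih, ih']
  | ex_congr _ _ ih => simp only [Form.val, ih]
  | subst_congr _ _ ih => simp only [Form.val, ih]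
  | and_comm => exact Set.inter_comm _ _
  | or_comm => exact Set.union_comm _ _
  | and_assoc => exact Set.inter_assoc _ _ _
  | or_assoc => exact Set.union_assoc _ _ _
  | and_or_self => exact inf_sup_self
  | or_and_self => exact sup_inf_self
  | and_or => exact Set.inter_union_distrib_left _ _ _
  | or_and => exact Set.union_inter_distrib_left _ _ _
  | and_neg => exact Set.inter_compl_self _
  | or_neg => exact Set.union_compl_self _
  | ex_bot => ext μ; simp [Form.val, pointsEx]
  | le_ex x a => exact Set.inter_eq_left.2 fun μ h => ⟨μ, h, fun _ _ => rfl⟩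
  | ex_and_ex x a b =>
    ext μ
    constructor
    · rintro ⟨ν, ⟨ha, ξ, hb, hξ⟩, hν⟩
      exact ⟨⟨ν, ha, hν⟩, ξ, hb, fun y hy => (hν y hy).trans (hξ y hy)⟩
    · rintro ⟨⟨ν, ha, hν⟩, ξ, hb, hξ⟩
      exact ⟨ν, ⟨ha, ξ, hb, fun y hy => (hν y hy).symm.trans (hξ y hy)⟩, hν⟩
  | @ex_comm X x y a =>
    have key : ∀ x y : {x // x ∈ X}, ∀ μ : W E X →[L] H, μ ∈ ((a.ex y).ex x).val H →
        μ ∈ ((a.ex x).ex y).val H := by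
      rintro x y μ ⟨ν, ⟨ξ, ha, hξ⟩, hν⟩
      by_cases hxy : x = y
      · subst hxy
        exact ⟨ν, ⟨ξ, ha, hξ⟩, hν⟩
      refine ⟨FreeAlg.lift (Function.update (fun z => μ (FreeAlg.var z)) y (ξ (FreeAlg.var y))),
        ⟨ξ, ha, fun z hz => ?_⟩, fun z hz => ?_⟩
      · by_cases hzy : z = y
        · subst hzy; simp
        · simp only [FreeAlg.lift_var, Function.update_of_ne hzy]
          exact (hν z hz).trans (hξ z hzy)
      · simp [Function.update_of_ne hz]
    ext μ
    exact ⟨key x y μ, key y x μ⟩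
  | eq_refl w => ext μ; simp [Form.val, pointsEq]
  | eq_symm w w' => ext μ; simp only [Form.val, pointsEq, Set.mem_inter_iff, Set.mem_ofPred_eq]
                    exact ⟨fun h => h.1, fun h => ⟨h, h.symm⟩⟩
  | eq_trans w w' w'' => exact Set.inter_eq_left.2 fun μ h => h.1.trans h.2
  | eq_func f w w' =>
    refine Set.inter_eq_left.2 fun μ h => ?_
    rw [Form.mem_val_eqs] at h
    change μ _ = μ _
    rw [Hom.map_fun, Hom.map_fun]
    congr 1
    exact funext h
  | subst_bot => rfl
  | subst_top => rfl
  | subst_neg => rfl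
  | subst_and => rfl
  | subst_or => rfl
  | subst_id => rfl
  | subst_comp => rfl
  | subst_ex_eq s s' x a h =>
    ext μ
    constructor
    · rintro ⟨ν, ha, hν⟩
      refine ⟨ν, ha, fun z hz => (Eq.trans ?_ (hν z hz))⟩
      exact congrArg μ (h z hz).symm
    · rintro ⟨ν, ha, hν⟩
      refine ⟨ν, ha, fun z hz => (Eq.trans ?_ (hν z hz))⟩
      exact congrArg μ (h z hz)
  | subst_ex s x y a hx hs =>
    ext μ
    constructor
    · rintro ⟨ν, ha, hν⟩
      let μ' : W E _ →[L] H :=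
        FreeAlg.lift (Function.update (fun z => μ (FreeAlg.var z)) y (ν (FreeAlg.var x)))
      have hμ' : ∀ z, z ≠ y → μ (FreeAlg.var z) = μ' (FreeAlg.var z) := fun z hz => by
        simp [μ', Function.update_of_ne hz]
      have hc : μ'.comp s = ν := by
        refine FreeAlg.hom_ext fun z => ?_
        by_cases hz : z = x
        · subst hz
          simp [hx, μ']
        · rw [← hν z hz]
          exact (FreeAlg.hom_eq_of_involves (S := {y}ᶜ) (fun t ht => (hμ' t ht).symm) (hs z hz))
      refine ⟨μ', ?_, hμ'⟩
      change μ'.comp s ∈ a.val H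
      rwa [hc]
    · rintro ⟨ν, ha, hν⟩
      refine ⟨ν.comp s, ha, fun z hz => ?_⟩
      exact FreeAlg.hom_eq_of_involves (S := {y}ᶜ) (fun t ht => hν t ht) (hs z hz)
  | subst_eq => rfl
  | subst_replace x w w' a =>
    refine Set.inter_eq_left.2 fun μ h => ?_
    have hc : μ.comp (FreeAlg.replace x w) = μ.comp (FreeAlg.replace x w') := by
      refine FreeAlg.hom_ext fun z => ?_
      by_cases hz : z = x
      · subst hz
        have h2 : μ w = μ w' := h.2
        simpa [FreeAlg.replace_var_self] using h2
      · simp [FreeAlg.replace_var_of_ne hz]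
    change μ.comp (FreeAlg.replace x w') ∈ a.val H
    rw [← hc]
    exact h.1

/-- The homomorphism `Val_H`, in the component of sort `X`. -/
def Val [InVariety E H] {X : Finset V} : Φ E X → Set (W E X →[L] H) :=
  Quotient.lift (fun a => a.val H) fun _ _ h => HalEq.val_eq H h

variable {H}

/-- The logical kernel of a point: all formulas of `Φ(X)` satisfied by it. -/
def LKer [InVariety E H] {X : Finset V} (μ : W E X →[L] H) : Set (Φ E X) :=
  {u | μ ∈ Val H u}

end MultiSorted

/-! ## The one-sorted algebra of first-order formulas -/

section OneSorted

variable {L : FirstOrder.Language.{u, u'}} [L.IsAlgebraic] (E : Set (L.Term ℕ × L.Term ℕ)) (V : Type v)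

/-- Pure first-order formulas, with equalities `w ≡ w'`, `w, w' ∈ W(X⁰)`, where `V` is `X⁰`. -/
inductive PureForm : Type (max u v)
  | eq (w w' : FreeAlg E V) : PureForm
  | bot : PureForm
  | top : PureForm
  | neg (a : PureForm) : PureForm
  | and (a b : PureForm) : PureForm
  | or (a b : PureForm) : PureForm
  | ex (x : V) (a : PureForm) : PureForm

variable {E V}

namespace PureForm

abbrev imp (a b : PureForm E V) : PureForm E V := a.neg.or b

abbrev all (x : V) (a : PureForm E V) : PureForm E V := (a.neg.ex x).neg

/-- All free variables belong to `S`. -/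
def FreeIn : Set V → PureForm E V → Prop
  | S, .eq w w' => FreeAlg.Involves S w ∧ FreeAlg.Involves S w'
  | _, .bot => True
  | _, .top => True
  | S, .neg a => a.FreeIn S
  | S, .and a b => a.FreeIn S ∧ b.FreeIn S
  | S, .or a b => a.FreeIn S ∧ b.FreeIn S
  | S, .ex x a => a.FreeIn (insert x S)

/-- All bound (quantified) variables belong to `S`. -/
def BoundIn (S : Set V) : PureForm E V → Prop
  | .eq _ _ => True
  | .bot => True
  | .top => True
  | .neg a => a.BoundIn S
  | .and a b => a.BoundIn S ∧ b.BoundIn S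
  | .or a b => a.BoundIn S ∧ b.BoundIn S
  | .ex x a => x ∈ S ∧ a.BoundIn S

/-- The variable `x` is not free in the formula. -/
abbrev NotFree (x : V) (a : PureForm E V) : Prop := a.FreeIn {x}ᶜ

/-- No variable of `w` becomes bound when `w` is substituted for the free occurrences of `x`. -/
def Substitutable (x : V) (w : FreeAlg E V) : PureForm E V → Prop
  | .eq _ _ => True
  | .bot => True
  | .top => True
  | .neg a => a.Substitutable x w
  | .and a b => a.Substitutable x w ∧ b.Substitutable x w
  | .or a b => a.Substitutable x w ∧ b.Substitutable x w
  | .ex y a => NotFree x (.ex y a) ∨ (FreeAlg.Involves {y}ᶜ w ∧ a.Substitutable x w)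

open Classical in
/-- Substitution of `w` for the free occurrences of `x`. -/
noncomputable def subst (x : V) (w : FreeAlg E V) : PureForm E V → PureForm E V
  | .eq w₁ w₂ => .eq (FreeAlg.replace x w w₁) (FreeAlg.replace x w w₂)
  | .bot => .bot
  | .top => .top
  | .neg a => .neg (a.subst x w)
  | .and a b => .and (a.subst x w) (b.subst x w)
  | .or a b => .or (a.subst x w) (b.subst x w)
  | .ex y a => if y = x then .ex y a else .ex y (a.subst x w)

/-- Instances of propositional tautologies: formulas true under every assignment of truth values
that respects the propositional connectives. -/
def Tautology (a : PureForm E V) : Prop :=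
  ∀ T : PureForm E V → Prop, ¬ T .bot → T .top → (∀ b, T b.neg ↔ ¬ T b) →
    (∀ b c, T (b.and c) ↔ T b ∧ T c) → (∀ b c, T (b.or c) ↔ T b ∨ T c) → T a

/-- Derivability in the first-order calculus with equality over the variety: the usual Hilbert
calculus (the identities of the variety are built into the algebra `W(X⁰)`). -/
inductive Provable : PureForm E V → Prop
  | taut {a : PureForm E V} : a.Tautology → Provable a
  | mp {a b : PureForm E V} : Provable (a.imp b) → Provable a → Provable b
  | gen (x : V) {a : PureForm E V} : Provable a → Provable (a.all x)
  | inst (x : V) (w : FreeAlg E V) (a : PureForm E V) : a.Substitutable x w →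
      Provable ((a.all x).imp (a.subst x w))
  | all_imp (x : V) (a b : PureForm E V) : a.NotFree x →
      Provable (((a.imp b).all x).imp (a.imp (b.all x)))
  | eq_refl (w : FreeAlg E V) : Provable (.eq w w)
  | eq_subst (x : V) (w w' : FreeAlg E V) (a : PureForm E V) :
      a.Substitutable x w → a.Substitutable x w' →
      Provable ((PureForm.eq w w').imp ((a.subst x w).imp (a.subst x w')))

variable (H : Type w) [L.Structure H]

/-- The set of points `W(X⁰) → H` satisfying a formula. -/
def val : PureForm E V → Set (FreeAlg E V →[L] H)
  | .eq w w' => pointsEq H w w'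
  | .bot => ∅
  | .top => Set.univ
  | .neg a => (a.val)ᶜ
  | .and a b => a.val ∩ b.val
  | .or a b => a.val ∪ b.val
  | .ex x a => pointsEx x a.val

theorem mem_val_imp {a b : PureForm E V} {η : FreeAlg E V →[L] H} :
    η ∈ (a.imp b).val H ↔ (η ∈ a.val H → η ∈ b.val H) := by
  simp only [val, Set.mem_union, Set.mem_compl_iff]
  tauto

theorem mem_val_all {x : V} {a : PureForm E V} {η : FreeAlg E V →[L] H} :
    η ∈ (a.all x).val H ↔
      ∀ ξ : FreeAlg E V →[L] H, (∀ y, y ≠ x → η (FreeAlg.var y) = ξ (FreeAlg.var y)) →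
        ξ ∈ a.val H := by
  simp only [val, pointsEx, Set.mem_compl_iff, Set.mem_ofPred_eq]
  push Not
  constructor
  · intro h ξ hξ
    by_contra hc
    obtain ⟨y, hy, hne⟩ := h ξ hc
    exact hne (hξ y hy)
  · intro h ξ hc
    by_contra! hξ
    exact hc (h ξ hξ)

theorem mem_val_congr [InVariety E H] {a : PureForm E V} {S : Set V} (ha : a.FreeIn S)
    {η ξ : FreeAlg E V →[L] H} (h : ∀ x ∈ S, η (FreeAlg.var x) = ξ (FreeAlg.var x)) :
    η ∈ a.val H ↔ ξ ∈ a.val H := by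
  classical
  induction a generalizing S η ξ with
  | eq w w' =>
    change η w = η w' ↔ ξ w = ξ w'
    rw [FreeAlg.hom_eq_of_involves h ha.1, FreeAlg.hom_eq_of_involves h ha.2]
  | bot => exact Iff.rfl
  | top => exact Iff.rfl
  | neg a ih => exact not_congr (ih ha h)
  | and a b iha ihb => exact and_congr (iha ha.1 h) (ihb ha.2 h)
  | or a b iha ihb => exact or_congr (iha ha.1 h) (ihb ha.2 h)
  | ex x a ih =>
    have key : ∀ η ξ : FreeAlg E V →[L] H,
        (∀ x ∈ S, η (FreeAlg.var x) = ξ (FreeAlg.var x)) →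
        η ∈ (PureForm.ex x a).val H → ξ ∈ (PureForm.ex x a).val H := by
      rintro η ξ h ⟨ν, hν, hην⟩
      refine ⟨FreeAlg.lift (Function.update (fun z => ξ (FreeAlg.var z)) x (ν (FreeAlg.var x))),
        (ih (S := insert x S) ha fun z hz => ?_).1 hν, fun z hz => by
          simp [Function.update_of_ne hz]⟩
      by_cases hzx : z = x
      · subst hzx; simp
      · simp only [FreeAlg.lift_var, Function.update_of_ne hzx]
        rw [← hην z hzx]
        exact h z (hz.resolve_left hzx)
    exact ⟨key η ξ h, key ξ η fun z hz => (h z hz).symm⟩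

theorem mem_val_subst [InVariety E H] {x : V} {w : FreeAlg E V} {a : PureForm E V}
    (ha : a.Substitutable x w) {η : FreeAlg E V →[L] H} :
    η ∈ (a.subst x w).val H ↔ η.comp (FreeAlg.replace x w) ∈ a.val H := by
  classical
  have hne : ∀ (ξ : FreeAlg E V →[L] H) z, z ≠ x →
      (ξ.comp (FreeAlg.replace x w)) (FreeAlg.var z) = ξ (FreeAlg.var z) := fun ξ z hz => by
    simp [FreeAlg.replace_var_of_ne hz]
  have hself : ∀ ξ : FreeAlg E V →[L] H,
      (ξ.comp (FreeAlg.replace x w)) (FreeAlg.var x) = ξ w := fun ξ => by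
    simp [FreeAlg.replace_var_self]
  -- substitution for a variable that is not free changes nothing
  have hnf : ∀ b : PureForm E V, ∀ S : Set V, x ∉ S → b.FreeIn S → b.subst x w = b := by
    have hid : ∀ S : Set V, x ∉ S → ∀ t : FreeAlg E V, FreeAlg.Involves S t →
        FreeAlg.replace x w t = t := fun S hS t ht =>
      FreeAlg.hom_eq_of_involves (g := Hom.id L _) (S := S)
        (fun z hz => FreeAlg.replace_var_of_ne (fun h : z = x => hS (h ▸ hz)) w) ht
    intro b
    induction b with
    | eq t t' => intro S hS hb; simp only [subst, hid S hS t hb.1, hid S hS t' hb.2]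
    | bot => intros; rfl
    | top => intros; rfl
    | neg b ih => intro S hS hb; simp only [subst, ih S hS hb]
    | and b c ihb ihc => intro S hS hb; simp only [subst, ihb S hS hb.1, ihc S hS hb.2]
    | or b c ihb ihc => intro S hS hb; simp only [subst, ihb S hS hb.1, ihc S hS hb.2]
    | ex y b ih =>
      intro S hS hb
      by_cases hy : y = x
      · simp [subst, hy]
      · simp only [subst, if_neg hy]
        rw [ih (insert y S) (by simp [Ne.symm hy, hS]) hb]
  induction a generalizing η with
  | eq t t' => exact Iff.rfl
  | bot => exact Iff.rfl
  | top => exact Iff.rfl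
  | neg a ih => exact not_congr (ih ha)
  | and a b iha ihb => exact and_congr (iha ha.1) (ihb ha.2)
  | or a b iha ihb => exact or_congr (iha ha.1) (ihb ha.2)
  | ex y a ih =>
    by_cases hfree : NotFree x (PureForm.ex y a)
    · rw [hnf _ _ (by simp) hfree]
      exact mem_val_congr H hfree fun z hz => (hne η z hz).symm
    by_cases hy : y = x
    · subst hy
      rw [(by simp [subst] : (PureForm.ex y a).subst y w = PureForm.ex y a)]
      constructor
      · rintro ⟨ν, hν, h⟩
        exact ⟨ν, hν, fun z hz => (hne η z hz).trans (h z hz)⟩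
      · rintro ⟨ν, hν, h⟩
        exact ⟨ν, hν, fun z hz => (hne η z hz).symm.trans (h z hz)⟩
    obtain ⟨hw, ha⟩ := ha.resolve_left hfree
    rw [(by simp [subst, hy] : (PureForm.ex y a).subst x w = PureForm.ex y (a.subst x w))]
    constructor
    · rintro ⟨ν, hν, h⟩
      refine ⟨_, (ih ha).1 hν, fun z hz => ?_⟩
      by_cases hzx : z = x
      · subst hzx
        rw [hself, hself]
        exact FreeAlg.hom_eq_of_involves (S := {y}ᶜ) (fun t ht => h t ht) hw
      · rw [hne _ _ hzx, hne _ _ hzx]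
        exact h z hz
    · rintro ⟨ν, hν, h⟩
      let ξ : FreeAlg E V →[L] H :=
        FreeAlg.lift (Function.update (fun z => η (FreeAlg.var z)) y (ν (FreeAlg.var y)))
      have hξ : ∀ z, z ≠ y → η (FreeAlg.var z) = ξ (FreeAlg.var z) := fun z hz => by
        simp [ξ, Function.update_of_ne hz]
      have hc : ξ.comp (FreeAlg.replace x w) = ν := by
        refine FreeAlg.hom_ext fun z => ?_
        by_cases hzx : z = x
        · subst hzx
          rw [← h z (Ne.symm hy), hself, hself]
          exact FreeAlg.hom_eq_of_involves (S := {y}ᶜ) (fun t ht => (hξ t ht).symm) hw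
        · rw [hne _ _ hzx]
          by_cases hzy : z = y
          · subst hzy
            simp [ξ]
          · rw [← hξ z hzy, ← hne η z hzx, h z hzy]
      exact ⟨ξ, (ih ha).2 (by rwa [hc]), hξ⟩

/-- Derivable formulas are satisfied by all points of all algebras of the variety. -/
theorem Provable.mem_val [InVariety E H] {a : PureForm E V} (h : a.Provable)
    (η : FreeAlg E V →[L] H) : η ∈ a.val H := by
  induction h generalizing η with
  | taut h =>
    exact h (fun b => η ∈ b.val H) (fun h => h) trivial (fun _ => Iff.rfl) (fun _ _ => Iff.rfl)
      (fun _ _ => Iff.rfl)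
  | mp _ _ ih ih' => exact (mem_val_imp H).1 (ih η) (ih' η)
  | gen x _ ih => exact (mem_val_all H).2 fun ξ _ => ih ξ
  | inst x w a ha =>
    refine (mem_val_imp H).2 fun h => (mem_val_subst H ha).2 ((mem_val_all H).1 h _ ?_)
    intro z hz
    simp [FreeAlg.replace_var_of_ne hz]
  | all_imp x a b ha =>
    refine (mem_val_imp H).2 fun h => (mem_val_imp H).2 fun h' => (mem_val_all H).2 fun ξ hξ => ?_
    exact (mem_val_imp H).1 ((mem_val_all H).1 h ξ hξ) ((mem_val_congr H ha hξ).1 h')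
  | eq_refl w => exact rfl
  | eq_subst x w w' a ha ha' =>
    refine (mem_val_imp H).2 fun h => (mem_val_imp H).2 fun h' => ?_
    rw [mem_val_subst H ha] at h'
    rw [mem_val_subst H ha']
    have hc : η.comp (FreeAlg.replace x w) = η.comp (FreeAlg.replace x w') := by
      refine FreeAlg.hom_ext fun z => ?_
      by_cases hz : z = x
      · subst hz
        have h2 : η w = η w' := h
        simpa [FreeAlg.replace_var_self] using h2
      · simp [FreeAlg.replace_var_of_ne hz]
    rwa [← hc]

end PureForm

variable (E V) in
/-- Provable equivalence of formulas. -/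
def pureSetoid : Setoid (PureForm E V) where
  r a b := ((a.imp b).and (b.imp a)).Provable
  iseqv :=
    { refl := fun a => .taut fun T _ _ hn ha ho => by simp only [hn, ha, ho]; tauto
      symm := fun {a b} h => .mp (.taut fun T _ _ hn ha ho => by simp only [hn, ha, ho]; tauto) h
      trans := fun {a b c} h h' =>
        .mp (.mp (.taut fun T _ _ hn ha ho => by simp only [hn, ha, ho]; tauto) h) h' }

variable (E V) in
/-- The one-sorted algebra of formulas `Φ(X⁰)`: the Lindenbaum-Tarski algebra. -/
def Φ₀ : Type (max u v) := Quotient (pureSetoid E V)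

/-- The set `Val^{X⁰}_H(u)` of points `W(X⁰) → H` that satisfy `u ∈ Φ(X⁰)`. -/
def Val₀ (H : Type w) [L.Structure H] [InVariety E H] : Φ₀ E V → Set (FreeAlg E V →[L] H) :=
  Quotient.lift (fun a => a.val H) fun a b h => by
    ext η
    have := PureForm.Provable.mem_val H h η
    exact ⟨(PureForm.mem_val_imp H).1 this.1, (PureForm.mem_val_imp H).1 this.2⟩

/-- `u ∈ Φ(X⁰)` is `X`-special: it is the class of a formula all whose free variables are in `X`
and all whose bound variables are in `Y⁰ = X⁰ \ X`. -/
def IsSpecial (X : Finset V) (u : Φ₀ E V) : Prop :=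
  ∃ a : PureForm E V, a.FreeIn (X : Set V) ∧ a.BoundIn (X : Set V)ᶜ ∧
    Quotient.mk (pureSetoid E V) a = u

/-- The model-theoretic type `Tp^H(μ)`: all `X`-special `u(x₁,…,xₙ; y₁,…,yₘ)` such that the
formula `u(μ(x₁),…,μ(xₙ); y₁,…,yₘ)` is satisfied in `H`, that is, such that `u` is satisfied by
every point `η : W(X⁰) → H` with `η(xᵢ) = μ(xᵢ)`. -/
def Tp {H : Type w} [L.Structure H] [InVariety E H] {X : Finset V} (μ : W E X →[L] H) :
    Set (Φ₀ E V) :=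
  {u | IsSpecial X u ∧ ∀ η : FreeAlg E V →[L] H,
    (∀ x : {x // x ∈ X}, η (FreeAlg.var x.1) = μ (FreeAlg.var x)) → η ∈ Val₀ H u}

end OneSorted

end AlgLogic

/-! The algebra `Φ(X)` and the `X`-special first-order formulas express the same properties of a
point `W(X) → H`, uniformly in `H`. So each of `Tp μ` and `LKer μ` determines the other by a
translation that does not mention the point.

From `Φ(X)` to special formulas (`Form.toPure`): the operations `s_*` are eliminated by carrying
along the composite substitution `s : W(Y) → W(X⁰)` and applying it at the equalities. A quantifier
becomes one over a variable outside `X` that does not occur in `s`; such a variable exists because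
`Y` is finite and `X⁰` infinite. Back again (`PureForm.toForm`): `∃ x` is performed in the sort `Y ∪
{x}`, and the result is brought down to `Y` by substituting anything at all for `x`, on which the
quantified formula no longer depends.

Both translations act on representatives and are justified semantically, by `Form.mem_val_toPure`
and `PureForm.mem_val_toForm`: values are preserved in every algebra of the variety. That suffices,
since `Val` and `Val₀` are already defined on classes. The remaining gap is that a type quantifies
over all points of `W(X⁰)` extending `μ`. These all agree on a formula that is determined by the
restriction to `W(X)`, and non-emptiness of `W(X)` provides at least one of them; this is
`mk_mem_Tp_iff`. -/

namespace AlgLogic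

universe u u' v w

variable {L : FirstOrder.Language.{u, u'}} [L.IsAlgebraic] {E : Set (L.Term ℕ × L.Term ℕ)}
  {V : Type v}

/-! ### Finite supports, and the passage between `W(Y)` and `W(X⁰)` -/

namespace FreeAlg

theorem Involves.mono {α : Type v} {S T : Set α} (h : S ⊆ T) {w : FreeAlg E α}
    (hw : Involves S w) : Involves T w :=
  Substructure.closure_mono (Set.image_mono h) hw

theorem involves_var {α : Type v} {S : Set α} {x : α} (hx : x ∈ S) :
    Involves S (var x : FreeAlg E α) :=
  Substructure.subset_closure ⟨x, hx, rfl⟩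

/-- A homomorphism from `W(α)` takes values involving only variables from `S` as soon as it does so
on the generators. -/
theorem involves_map {α : Type*} {β : Type v} {S : Set β} (s : FreeAlg E α →[L] FreeAlg E β)
    (h : ∀ x, Involves S (s (var x))) (w : FreeAlg E α) : Involves S (s w) := by
  -- The preimage under `s` of the subalgebra generated by `S` is a subalgebra containing all
  -- generators, hence everything.
  have hle : (⊤ : L.Substructure (FreeAlg E α)) ≤
      (Substructure.closure L ((var : β → FreeAlg E β) '' S)).comap s := by
    rw [← closure_var, Substructure.closure_le]
    rintro _ ⟨x, rfl⟩
    exact h x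
  exact hle (Substructure.mem_top w)

/-- Every element of a free algebra involves only finitely many variables. -/
theorem exists_finset_involves {α : Type v} (w : FreeAlg E α) :
    ∃ F : Finset α, Involves (F : Set α) w := by
  classical
  obtain ⟨t, rfl⟩ := Quotient.exists_rep w
  change ∃ F : Finset α, Involves (F : Set α) (mk t)
  induction t with
  | var x => exact ⟨{x}, involves_var (by simp)⟩
  | func f ts ih =>
    choose F hF using ih
    refine ⟨Finset.univ.biUnion F, ?_⟩
    rw [← funMap_mk]
    refine (Substructure.closure L _).fun_mem f _ fun i => (hF i).mono ?_
    exact_mod_cast Finset.subset_biUnion_of_mem F (Finset.mem_univ i)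

/-- The inclusion `W(Y) → W(X⁰)`. -/
noncomputable def incl (E : Set (L.Term ℕ × L.Term ℕ)) (Y : Finset V) : W E Y →[L] FreeAlg E V :=
  lift fun x => var x.1

open Classical in
/-- The homomorphism `W(X⁰) → W(Y)` that fixes the variables from `Y` and takes all others
to `w`. -/
noncomputable def retract {Y : Finset V} (w : W E Y) : FreeAlg E V →[L] W E Y :=
  lift fun x => if h : x ∈ Y then var ⟨x, h⟩ else w

@[simp] theorem incl_var {Y : Finset V} (x : {x // x ∈ Y}) : incl E Y (var x) = var x.1 := rfl

theorem retract_var {Y : Finset V} (w : W E Y) {x : V} (h : x ∈ Y) :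
    retract w (var x) = var ⟨x, h⟩ := by
  simp [retract, h]

theorem retract_comp_incl {Y : Finset V} (w : W E Y) :
    (retract w).comp (incl E Y) = Hom.id L (W E Y) :=
  hom_ext fun x => retract_var w x.2

/-- The default value `w` is only used on variables outside `Y`, which are not needed to generate
`w'`. -/
theorem incl_retract {Y : Finset V} (w : W E Y) {w' : FreeAlg E V}
    (h : Involves (Y : Set V) w') : incl E Y (retract w w') = w' :=
  hom_eq_of_involves (f := (incl E Y).comp (retract w)) (g := Hom.id L _) (S := (Y : Set V))
    (fun _ hx => congrArg (incl E Y) (retract_var w hx)) h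

/-- A homomorphism from `W(Y)` only uses finitely many variables, so it avoids some variable
outside any given finite set. -/
theorem exists_fresh [Infinite V] (B : Finset V) {Y : Finset V} (s : W E Y →[L] FreeAlg E V) :
    ∃ y ∉ B, ∀ x, Involves {y}ᶜ (s (var x)) := by
  classical
  choose F hF using fun x : {x // x ∈ Y} => exists_finset_involves (s (var x))
  obtain ⟨y, hy⟩ := Infinite.exists_notMem_finset (B ∪ Finset.univ.biUnion F)
  simp only [Finset.mem_union, Finset.mem_biUnion, Finset.mem_univ, true_and, not_or,
    not_exists] at hy
  refine ⟨y, hy.1, fun x => (hF x).mono fun z hz hzy => ?_⟩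
  rw [Set.mem_singleton_iff] at hzy
  exact hy.2 x (hzy ▸ hz)

/-- A variable outside `B` not involved in the values of `s` on the generators. -/
noncomputable def fresh [Infinite V] (B : Finset V) {Y : Finset V}
    (s : W E Y →[L] FreeAlg E V) : V :=
  (exists_fresh B s).choose

theorem fresh_notMem [Infinite V] (B : Finset V) {Y : Finset V} (s : W E Y →[L] FreeAlg E V) :
    fresh B s ∉ B :=
  (exists_fresh B s).choose_spec.1

theorem involves_compl_fresh [Infinite V] (B : Finset V) {Y : Finset V}
    (s : W E Y →[L] FreeAlg E V) (x : {x // x ∈ Y}) : Involves {fresh B s}ᶜ (s (var x)) :=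
  (exists_fresh B s).choose_spec.2 x

open Classical in
/-- The homomorphism that takes the variable `x` to the variable `y` and agrees with `s` on the
other variables. -/
noncomputable def redirect {Y : Finset V} (s : W E Y →[L] FreeAlg E V) (x : {x // x ∈ Y}) (y : V) :
    W E Y →[L] FreeAlg E V :=
  lift (Function.update (fun z => s (var z)) x (var y))

theorem redirect_var_self {Y : Finset V} (s : W E Y →[L] FreeAlg E V) (x : {x // x ∈ Y}) (y : V) :
    redirect s x y (var x) = var y := by
  simp [redirect]

theorem redirect_var_of_ne {Y : Finset V} (s : W E Y →[L] FreeAlg E V) {x z : {x // x ∈ Y}}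
    (h : z ≠ x) (y : V) : redirect s x y (var z) = s (var z) := by
  simp [redirect, h]

variable {H : Type w} [L.Structure H] [InVariety E H]

/-- Points `W(α) → H` may be changed in one variable. -/
theorem exists_update {α : Type v} (η : FreeAlg E α →[L] H) (x : α) (h : H) :
    ∃ ξ : FreeAlg E α →[L] H, ξ (var x) = h ∧ ∀ z, z ≠ x → η (var z) = ξ (var z) := by
  classical
  exact ⟨lift (Function.update (fun z => η (var z)) x h), by simp, fun z hz => by simp [hz]⟩

end FreeAlg

open FreeAlg

/-! ## From multi-sorted formulas to pure first-order formulas -/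

section ToPure

variable [Infinite V] (B : Finset V)

/-- The first-order formula obtained from a multi-sorted one by substituting along `s`, with all
bound variables renamed so as to lie outside `B`. -/
noncomputable def Form.toPure :
    {Y : Finset V} → Form E Y → (W E Y →[L] FreeAlg E V) → PureForm E V
  | _, .eq w w', s => .eq (s w) (s w')
  | _, .bot, _ => .bot
  | _, .top, _ => .top
  | _, .neg a, s => .neg (a.toPure s)
  | _, .and a b, s => .and (a.toPure s) (b.toPure s)
  | _, .or a b, s => .or (a.toPure s) (b.toPure s)
  | _, .ex x a, s => .ex (fresh B s) (a.toPure (redirect s x (fresh B s)))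
  | _, .subst s' a, s => a.toPure (s.comp s')

theorem Form.boundIn_toPure {Y : Finset V} (a : Form E Y) (s : W E Y →[L] FreeAlg E V) :
    (a.toPure B s).BoundIn (B : Set V)ᶜ := by
  induction a with
  | eq | bot | top => trivial
  | neg a ih => exact ih s
  | and a b iha ihb | or a b iha ihb => exact ⟨iha s, ihb s⟩
  | ex x a ih => exact ⟨fresh_notMem B s, ih _⟩
  | subst s' a ih => exact ih _

/-- With `s` the inclusion of `W(X)` and `B = S = X`, this and `Form.boundIn_toPure` make the
translated formula `X`-special. The set `S` must vary in the induction, because it gains the fresh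
variable under a quantifier. -/
theorem Form.freeIn_toPure {Y : Finset V} (a : Form E Y) (s : W E Y →[L] FreeAlg E V) {S : Set V}
    (hs : ∀ x, Involves S (s (var x))) : (a.toPure B s).FreeIn S := by
  induction a generalizing S with
  | eq w w' => exact ⟨involves_map s hs w, involves_map s hs w'⟩
  | bot | top => trivial
  | neg a ih => exact ih s hs
  | and a b iha ihb | or a b iha ihb => exact ⟨iha s hs, ihb s hs⟩
  | ex x a ih =>
    refine ih _ fun z => ?_
    by_cases hz : z = x
    · subst hz
      rw [redirect_var_self]
      exact involves_var (Set.mem_insert _ _)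
    · rw [redirect_var_of_ne s hz]
      exact (hs z).mono (Set.subset_insert _ _)
  | subst s' a ih => exact ih _ fun x => involves_map s hs _

/-- Substitution acts on points by composition, so only the quantifier needs an argument: moving `η`
at the fresh variable moves `η.comp (redirect s x (fresh B s))` at `x` and nowhere else. -/
theorem Form.mem_val_toPure {H : Type w} [L.Structure H] [InVariety E H] {Y : Finset V}
    (a : Form E Y) (s : W E Y →[L] FreeAlg E V) (η : FreeAlg E V →[L] H) :
    η ∈ (a.toPure B s).val H ↔ η.comp s ∈ a.val H := by
  induction a generalizing η with
  | eq | bot | top => exact Iff.rfl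
  | neg a ih => exact not_congr (ih s η)
  | and a b iha ihb => exact and_congr (iha s η) (ihb s η)
  | or a b iha ihb => exact or_congr (iha s η) (ihb s η)
  | subst s' a ih => exact ih _ η
  | ex x a ih =>
    -- Freshness enters here: `s (var z)` does not involve the new variable, so changing `η` there
    -- leaves its value alone.
    have key : ∀ ξ : FreeAlg E V →[L] H,
        (∀ y, y ≠ fresh B s → η (var y) = ξ (var y)) → ∀ z, z ≠ x →
          η (s (var z)) = ξ (redirect s x (fresh B s) (var z)) := fun ξ hξ z hz => by
      rw [redirect_var_of_ne s hz]
      exact hom_eq_of_involves (S := {fresh B s}ᶜ) hξ (involves_compl_fresh B s z)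
    constructor
    · rintro ⟨ξ, hξ, h⟩
      exact ⟨_, (ih _ ξ).1 hξ, key ξ h⟩
    · rintro ⟨ζ, hζ, h⟩
      -- The witness `ζ` lives on `W(Y)`; its value at `x` is transferred to the fresh variable that
      -- now stands for `x`.
      obtain ⟨ξ, hx, hξ⟩ := exists_update η (fresh B s) (ζ (var x))
      refine ⟨ξ, (ih _ ξ).2 ?_, hξ⟩
      have hc : ξ.comp (redirect s x (fresh B s)) = ζ := by
        refine hom_ext fun z => ?_
        by_cases hz : z = x
        · subst hz
          simpa [redirect_var_self] using hx
        · exact (key ξ hξ z hz).symm.trans (h z hz)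
      rwa [hc]

end ToPure

/-! ## From pure first-order formulas to multi-sorted formulas -/

open Classical in
/-- The multi-sorted formula of sort `Y` corresponding to a first-order formula with free variables
in `Y`. A quantifier `∃ x` is taken in the sort `Y ∪ {x}`, from where one returns to the sort `Y`
by a substitution for `x`, for which an element of `W(Y)` is needed. -/
noncomputable def PureForm.toForm : PureForm E V → {Y : Finset V} → W E Y → Form E Y
  | .eq w₁ w₂, _, w => .eq (retract w w₁) (retract w w₂)
  | .bot, _, _ => .bot
  | .top, _, _ => .top
  | .neg a, _, w => .neg (a.toForm w)
  | .and a b, _, w => .and (a.toForm w) (b.toForm w)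
  | .or a b, _, w => .or (a.toForm w) (b.toForm w)
  | .ex x a, Y, w =>
    .subst ((retract w).comp (incl E (insert x Y)))
      (.ex ⟨x, Finset.mem_insert_self x Y⟩
        (a.toForm (var ⟨x, Finset.mem_insert_self x Y⟩ : W E (insert x Y))))

/-- At a quantifier the point is sent from `W(Y)` to `W(Y ∪ {x})` with an arbitrary value at `x`,
which `∃ x` then forgets; hence the choice of `w` is immaterial. Nothing is assumed about bound
variables: `x` may already belong to `Y`. -/
theorem PureForm.mem_val_toForm {H : Type w} [L.Structure H] [InVariety E H] (a : PureForm E V)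
    {Y : Finset V} (w : W E Y) (ha : a.FreeIn (Y : Set V)) (η : FreeAlg E V →[L] H) :
    η.comp (incl E Y) ∈ (a.toForm w).val H ↔ η ∈ a.val H := by
  classical
  induction a generalizing Y η with
  | eq w₁ w₂ =>
    change η (incl E Y (retract w w₁)) = η (incl E Y (retract w w₂)) ↔ η w₁ = η w₂
    rw [incl_retract w ha.1, incl_retract w ha.2]
  | bot | top => exact Iff.rfl
  | neg a ih => exact not_congr (ih w ha η)
  | and a b iha ihb => exact and_congr (iha w ha.1 η) (ihb w ha.2 η)
  | or a b iha ihb => exact or_congr (iha w ha.1 η) (ihb w ha.2 η)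
  | ex x a ih =>
    have ha' : a.FreeIn ((insert x Y : Finset V) : Set V) := by
      rw [Finset.coe_insert]
      exact ha
    -- The variables other than `x` lie in `Y` and survive the retraction, whereas `x` itself goes
    -- to `w` when `x ∉ Y`.
    have hret : ∀ z : {z // z ∈ insert x Y}, z ≠ ⟨x, Finset.mem_insert_self x Y⟩ →
        incl E Y (retract w (incl E (insert x Y) (var z))) = var z.1 := fun z hz => by
      rw [incl_var]
      refine incl_retract w (involves_var ?_)
      exact (Finset.mem_insert.1 z.2).resolve_left fun h => hz (Subtype.ext h)
    constructor
    · rintro ⟨ζ, hζ, h⟩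
      -- `ζ` is defined on `W(Y ∪ {x})` only; changing `η` at `x` extends it to `W(X⁰)`.
      obtain ⟨ξ, hx, hξ⟩ := exists_update η x (ζ (var ⟨x, Finset.mem_insert_self x Y⟩))
      refine ⟨ξ, (ih (var ⟨x, Finset.mem_insert_self x Y⟩) ha' ξ).1 ?_, hξ⟩
      have hc : ξ.comp (incl E (insert x Y)) = ζ := by
        refine hom_ext fun z => ?_
        by_cases hz : z = ⟨x, Finset.mem_insert_self x Y⟩
        · subst hz
          exact hx
        · refine Eq.trans ?_ (h z hz)
          change ξ (var z.1) = η (incl E Y (retract w (incl E (insert x Y) (var z))))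
          rw [hret z hz]
          exact (hξ z.1 fun h => hz (Subtype.ext h)).symm
      rwa [hc]
    · rintro ⟨ξ, hξ, h⟩
      refine ⟨_, (ih _ ha' ξ).2 hξ, fun z hz => ?_⟩
      change η (incl E Y (retract w (incl E (insert x Y) (var z)))) = ξ (var z.1)
      rw [hret z hz]
      exact h z.1 fun h => hz (Subtype.ext h)

/-! ## Types and logical kernels -/

section Types

variable {H : Type w} [L.Structure H] [InVariety E H] {X : Finset V}

omit [InVariety E H] in
theorem comp_incl_eq_iff {μ : W E X →[L] H} {η : FreeAlg E V →[L] H} :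
    η.comp (incl E X) = μ ↔ ∀ x : {x // x ∈ X}, η (var x.1) = μ (var x) :=
  ⟨fun h _ => h ▸ rfl, fun h => hom_ext h⟩

/-- Membership of a formula in the type of `μ` can be tested by any formula of sort `X` that takes
the same values. -/
theorem mk_mem_Tp_iff [Nonempty (W E X)] (μ : W E X →[L] H) {a : Form E X} {b : PureForm E V}
    (hb : IsSpecial X (Quotient.mk (pureSetoid E V) b))
    (hab : ∀ η : FreeAlg E V →[L] H, η ∈ b.val H ↔ η.comp (incl E X) ∈ a.val H) :
    Quotient.mk (pureSetoid E V) b ∈ Tp μ ↔ Quotient.mk (formSetoid E X) a ∈ LKer μ := by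
  obtain ⟨w⟩ := ‹Nonempty (W E X)›
  constructor
  · intro h
    -- Some extension of `μ` to `W(X⁰)` is needed, as otherwise membership in the type would be
    -- vacuous. This one sends every variable outside `X` to `μ w`.
    have hμ : (μ.comp (retract w)).comp (incl E X) = μ := by
      rw [Hom.comp_assoc, retract_comp_incl, Hom.comp_id]
    have := (hab _).1 (h.2 (μ.comp (retract w)) (comp_incl_eq_iff.1 hμ))
    rwa [hμ] at this
  · intro h
    -- By `hab` the truth of `b` at `η` depends only on the restriction of `η` to `W(X)`, which is
    -- `μ` for every `η` considered.
    refine ⟨hb, fun η hη => (hab η).2 ?_⟩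
    rw [comp_incl_eq_iff.2 hη]
    exact h

end Types

end AlgLogic

open AlgLogic in
theorem theorem3p4 {L : FirstOrder.Language} [L.IsAlgebraic] (E : Set (L.Term ℕ × L.Term ℕ))
    {V : Type*} [Infinite V] (X : Finset V) [Nonempty (W E X)]
    {H₁ : Type*} [L.Structure H₁] [InVariety E H₁]
    {H₂ : Type*} [L.Structure H₂] [InVariety E H₂]
    (μ : W E X →[L] H₁) (ν : W E X →[L] H₂) :
    Tp μ = Tp ν ↔ LKer μ = LKer ν := by
  constructor
  · intro h
    ext u
    obtain ⟨a, rfl⟩ := Quotient.exists_rep u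
    -- One special formula tests membership of `a` in both kernels, since the translation depends on
    -- neither `μ` nor `ν`.
    have ha : IsSpecial X (Quotient.mk (pureSetoid E V) (a.toPure X (FreeAlg.incl E X))) :=
      ⟨_, a.freeIn_toPure X _ fun x => FreeAlg.involves_var x.2, a.boundIn_toPure X _, rfl⟩
    exact (mk_mem_Tp_iff μ ha (a.mem_val_toPure X _)).symm.trans
      ((Set.ext_iff.1 h _).trans (mk_mem_Tp_iff ν ha (a.mem_val_toPure X _)))
  · intro h
    ext u
    by_cases hu : IsSpecial X u
    · obtain ⟨w⟩ := ‹Nonempty (W E X)›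
      have hu' := hu
      -- Only the condition on free variables is needed to translate `b` into sort `X`; the one on
      -- bound variables is dropped.
      obtain ⟨b, hb, -, rfl⟩ := hu'
      exact (mk_mem_Tp_iff μ hu fun η => (b.mem_val_toForm w hb η).symm).trans
        ((Set.ext_iff.1 h _).trans
          (mk_mem_Tp_iff ν hu fun η => (b.mem_val_toForm w hb η).symm).symm)
    · exact ⟨fun h' => absurd h'.1 hu, fun h' => absurd h'.1 hu⟩
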